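/- Let $p$ be a prime. For integers $m\ge 1$, $0\le n<p^{p^m}$ and $0\le k<p^m$ write $n=\sum_{j=0}^{p^m-1}e_j(n)\,p^j$ with $e_j(n)\in\{0,1,\dots,p-1\}$ and let $d_k(n)\in\{0,1,\dots,p-1\}$ be the residue $$d_k(n)\equiv\sum_{j=0}^{p^m-1}\binom{k+j}{j}e_j(n)\pmod p .$$ Let $\mathcal A_m$ be the word of length $p^m\cdot p^{p^m}$ $$d_0(0)\cdots d_{p^m-1}(0)\;\;d_0(1)\cdots d_{p^m-1}(1)\;\;\cdots\;\;d_0(p^{p^m}-1)\cdots d_{p^m-1}(p^{p^m}-1)$$ (the $p$-ary affine necklace of order $m$ with parameters $z=\eta=0$, $u=1$), and let $\alpha\in[0,1)$ be the number whose base-$p$ expansion is the concatenation $0.\mathcal A_1\mathcal A_2\mathcal A_3\cdots$ (Levin's normal number in base $p$). For $N\ge 1$ let $$D_N^*=\sup_{0<c\le 1}\left|\frac1N\#\{0\le n<N:\ 0\le\{p^n\alpha\}<c\}-c\right|$$ be the star discrepancy of the sequence $(\{p^n\alpha\})_{n\ge 0}$. Then there is a constant $c_p>0$, depending only on $p$,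 such that $$N D_N^*\ \ge\ c_p(\log N)^2\qquad\text{for infinitely many } N.$$ -/

import Mathlib

/-- The star discrepancy `D*_N` of a real sequence `x`: the supremum over `0 < c ≤ 1` of
`|#{0 ≤ n < N : 0 ≤ x_n < c} / N - c|`. -/
noncomputable def starDiscrepancy (x : ℕ → ℝ) (N : ℕ) : ℝ :=
  ⨆ c : Set.Ioc (0 : ℝ) 1,
    |(((Finset.range N).filter (fun n => 0 ≤ x n ∧ x n < (c : ℝ))).card : ℝ) / (N : ℝ) - (c : ℝ)|

namespace AffineNecklace

/-- The `j`-th base-`p` digit `e_j(n)` of `n`, least significant digit first. -/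
def baseDigit (p n j : ℕ) : ℕ := n / p ^ j % p

/-- The coefficient `binom (i + j - η_j) j * u_j`. For the admissible shifts, which satisfy
`η_0 = 0` and `η_j ≤ η_{j+1} ≤ η_j + 1`, one has `η_j ≤ j`, so the subtraction is a true one. -/
def coeff (η u : ℕ → ℕ) (i j : ℕ) : ℕ := (i + j - η j).choose j * u j

/-- The digit `d_k(n)` of the affine necklace of order `m` with parameters `z`, `η`, `u`:
`∑_{j < p^m} binom (k + j - η_j) j * u_j * e_j(n) + z_k`, reduced modulo `p`. -/
def digit (p : ℕ) [NeZero p] (m : ℕ) (z η u : ℕ → ℕ) (n k : ℕ) : Fin p :=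
  Fin.ofNat p (∑ j ∈ Finset.range (p ^ m), coeff η u k j * baseDigit p n j + z k)

/-- The number of digits `p^m * p^(p^m)` of the affine necklace of order `m`. -/
def length (p m : ℕ) : ℕ := p ^ m * p ^ (p ^ m)

/-- The entry at position `r` (counted from `0`) of the affine necklace of order `m`, which is the
word `d_0(0) … d_{p^m-1}(0) d_0(1) … d_{p^m-1}(1) … d_0(p^(p^m)-1) … d_{p^m-1}(p^(p^m)-1)`. -/
def entry (p : ℕ) [NeZero p] (m : ℕ) (z η u : ℕ → ℕ) (r : ℕ) : Fin p :=
  digit p m z η u (r / p ^ m) (r % p ^ m)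

/-- The number `n_m` of digits in the necklaces of orders `1, …, m - 1`. -/
def start (p m : ℕ) : ℕ := ∑ j ∈ Finset.Ico 1 m, length p j

/-- The order of the necklace in which position `i` (counted from `0`) of the concatenation lies,
that is, the `m ≥ 1` with `n_m ≤ i < n_{m+1}`. -/
noncomputable def blockIndex (p i : ℕ) : ℕ := sInf {m : ℕ | i < start p (m + 1)}

/-- The digit sequence, with positions counted from `0`, of the concatenation of the affine
necklaces of orders `1, 2, 3, …` with parameters `z m`, `η m`, `u m` in order `m`. -/
noncomputable def concat (p : ℕ) [NeZero p] (z η u : ℕ → ℕ → ℕ) (i : ℕ) : Fin p :=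
  entry p (blockIndex p i) (z (blockIndex p i)) (η (blockIndex p i)) (u (blockIndex p i))
    (i - start p (blockIndex p i))

end AffineNecklace

/-- Levin's number in base `p`: the real number whose base-`p` expansion `0.α₁α₂α₃…` is the
concatenation of the affine necklaces of orders `1, 2, 3, …` with `z = 0`, `η = 0` and `u = 1`. -/
noncomputable def levinNumber (p : ℕ) [NeZero p] : ℝ :=
  Real.ofDigits (AffineNecklace.concat p (fun _ _ => 0) (fun _ _ => 0) (fun _ _ => 1))

/-!
The star discrepancy is bounded from below by a single interval `[0, c)` and a single stretch of
positions inside the necklace of order `m`: if the points with indices in `[N₂, N₁)` hit `[0, c)`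
too rarely by `K`, then `N * D*_N ≥ K / 2` for `N = N₁` or `N = N₂`, so the earlier necklaces need
no analysis. Since `log N` is of order `p ^ m` there, `K` has to be of order `p ^ (2 * m)`.

Put `q = p ^ 4`, `c = ∑ t ≤ T, p ^ (-(q * t + 2))` with `T = p ^ (m - 8) - 1`, and take the first
`n₀ = ∑ i ≤ T, p ^ (q * i)` rows of the necklace (row `n` is `d_0(n) ⋯ d_{p^m-1}(n)`). A number
lies below `c` only if, for some `t ≤ T`, its expansion starts with the level word of length
`l = q * t + 2`, which agrees with the digits of `c` except for a `0` in place of the final `1`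
(`exists_levelWord_of_lt`). So it suffices to bound from above, for each column `k` and level `t`,
the number of `n < n₀` whose window at column `k` is this word; its expected value is
`n₀ * p ^ (-l)`.

* Always, it exceeds the expected value by at most `1`, because a window of length `l` determines
  `n` (or `n + 1`, if the window runs over into the next row) within a block of length `p ^ l`
  (`card_window_le`). This rests on the forward differences in `k` of the entries
  `∑ j, binom (k + j) k * e_j(n)`: the difference of order `a` is
  `∑ j, binom (k + j) (k + a) * e_j(n)`, a triangular system.
* For `t ≥ 1` and most `k`, it is at most the expected value minus `p ^ (-2)`
  (`card_levelRows_le_sub`), because the last, incomplete block contributes nothing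
  (`card_levelWord_le`). Modulo `p`, the difference of order `1 + q * t` is a difference of order
  `1` followed by `t` differences with step `q`, and applied to the word it gives `-1`. In terms of
  the digits of `n` it is `0`: the digits above `q * t + 1` are those of `n₀`, which sit at
  multiples of `q`, and there the relevant binomial coefficient is divisible by `p` unless
  `k ≡ -1` modulo `q`.

The exceptional columns, those with `k ≡ -1` modulo `q` or with a window that runs over, make up a
proportion of at most `2 * p ^ (-4)`, so the deficit prevails (`deficit_le`); summed over about
`p ^ m` columns and `T` levels it has the required order.
-/

open Finset

namespace AffineNecklace

/-! ### Binomial coefficients modulo a prime -/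

/-- The coefficientwise form of `(1 + X) ^ (x + q) = (1 + X ^ q) * (1 + X) ^ x` for `q = p ^ h`. -/
lemma cast_choose_add_pow (p : ℕ) [Fact p.Prime] (h x y : ℕ) :
    ((x + p ^ h).choose y : ZMod p) =
      x.choose y + if p ^ h ≤ y then (x.choose (y - p ^ h) : ZMod p) else 0 := by
  have key : ((1 + Polynomial.X : Polynomial (ZMod p)) ^ (x + p ^ h)) =
      (1 + Polynomial.X) ^ x + (1 + Polynomial.X) ^ x * Polynomial.X ^ (p ^ h) := by
    rw [pow_add, add_pow_char_pow, one_pow, mul_add, mul_one]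
  have := congrArg (fun f => Polynomial.coeff f y) key
  simpa only [Polynomial.coeff_add, Polynomial.coeff_mul_X_pow',
    Polynomial.coeff_one_add_X_pow] using this

lemma cast_choose_pow_add_of_lt (p : ℕ) [Fact p.Prime] {h x y : ℕ} (hy : y < p ^ h) :
    ((p ^ h + x).choose y : ZMod p) = x.choose y := by
  rw [add_comm, cast_choose_add_pow, if_neg (by omega), add_zero]

/-- The case of Lucas' theorem in which all of the lowest `h` digits of `y` equal `p - 1`. -/
lemma cast_choose_eq_zero (p : ℕ) [Fact p.Prime] (h : ℕ) (x y : ℕ)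
    (hy : y % p ^ h = p ^ h - 1) (hx : x % p ^ h ≠ p ^ h - 1) :
    (x.choose y : ZMod p) = 0 := by
  have hq : 0 < p ^ h := pow_pos (Fact.out : p.Prime).pos h
  induction x using Nat.strong_induction_on generalizing y with
  | _ x ih =>
    rcases lt_or_ge x (p ^ h) with hlt | hge
    · rw [Nat.mod_eq_of_lt hlt] at hx
      have := Nat.mod_le y (p ^ h)
      rw [Nat.choose_eq_zero_of_lt (by omega), Nat.cast_zero]
    · obtain ⟨z, rfl⟩ := Nat.exists_eq_add_of_le' hge
      rw [Nat.add_mod_right] at hx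
      rw [cast_choose_add_pow, ih z (by omega) y hy hx, zero_add]
      split_ifs with hle
      · refine ih z (by omega) _ ?_ hx
        rwa [← Nat.mod_eq_sub_mod hle]
      · rfl

/-! ### Differences of the Pascal matrix -/

/-- The sum `∑ j < J, binom (k + j) (k + a) * δ j`. For `a = 0` it is entry `k` of the product of
the Pascal matrix with `δ`, and in general it is the `a`-th forward difference of that case with
respect to `k`. -/
def pascalSum {p : ℕ} (J : ℕ) (δ : ℕ → ZMod p) (a k : ℕ) : ZMod p :=
  ∑ j ∈ range J, ((k + j).choose (k + a) : ZMod p) * δ j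

variable {p : ℕ} {J : ℕ} {δ : ℕ → ZMod p}

lemma pascalSum_succ (a k : ℕ) :
    pascalSum J δ (a + 1) k = pascalSum J δ a (k + 1) - pascalSum J δ a k := by
  simp only [pascalSum, ← sum_sub_distrib, ← sub_mul]
  refine sum_congr rfl fun j _ => ?_
  rw [show k + 1 + j = k + j + 1 by ring, show k + 1 + a = k + a + 1 by ring,
    Nat.choose_succ_succ, ← add_assoc]
  push_cast
  ring

/-- In characteristic `p` the `p ^ h`-fold difference is the difference with step `p ^ h`. -/
lemma pascalSum_add_pow [Fact p.Prime] (h a k : ℕ) :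
    pascalSum J δ (a + p ^ h) k = pascalSum J δ a (k + p ^ h) - pascalSum J δ a k := by
  simp only [pascalSum, ← sum_sub_distrib, ← sub_mul]
  refine sum_congr rfl fun j _ => ?_
  rw [show k + p ^ h + j = k + j + p ^ h by ring, cast_choose_add_pow, if_pos (by omega),
    show k + p ^ h + a - p ^ h = k + a by omega, show k + p ^ h + a = k + (a + p ^ h) by ring]
  ring

lemma pascalSum_eq_zero {a k : ℕ} (h0 : ∀ r ≤ a, pascalSum J δ 0 (k + r) = 0) :
    pascalSum J δ a k = 0 := by
  have key : ∀ b r, r + b ≤ a → pascalSum J δ b (k + r) = 0 := by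
    intro b
    induction b with
    | zero => intro r hr; exact h0 r hr
    | succ b ih =>
      intro r hr
      rw [pascalSum_succ, ih r (by omega), add_assoc, ih (r + 1) (by omega), sub_zero]
  exact key a 0 (by omega)

/-- The differences of order `a < l` form a triangular system in `δ 0, …, δ (l - 1)`, provided that
the later entries do not contribute. -/
lemma eq_zero_of_pascalSum_eq_zero {k l : ℕ} (hl : l ≤ J)
    (hδ : ∀ a < l, ∀ j, l ≤ j → j < J → ((k + j).choose (k + a) : ZMod p) * δ j = 0)
    (h0 : ∀ r < l, pascalSum J δ 0 (k + r) = 0) : ∀ j < l, δ j = 0 := by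
  have key : ∀ d j, l ≤ j + d → j < l → δ j = 0 := by
    intro d
    induction d with
    | zero => intro j h1 h2; omega
    | succ d ih =>
      intro a h1 ha
      have hS : pascalSum J δ a k = 0 := pascalSum_eq_zero fun r hr => h0 r (by omega)
      rw [pascalSum, sum_eq_single a] at hS
      · simpa using hS
      · intro j hj hja
        rcases lt_or_gt_of_ne hja with hlt | hgt
        · rw [Nat.choose_eq_zero_of_lt (by omega), Nat.cast_zero, zero_mul]
        · rcases lt_or_ge j l with hjl | hjl
          · rw [ih j (by omega) hjl, mul_zero]
          · exact hδ a ha j hjl (mem_range.mp hj)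
      · intro ha'
        exact absurd (mem_range.mpr (by omega)) ha'
  exact fun j hj => key l j (by omega) hj

lemma pascalSum_sub (δ' : ℕ → ZMod p) (a k : ℕ) :
    pascalSum J (fun j => δ j - δ' j) a k = pascalSum J δ a k - pascalSum J δ' a k := by
  simp only [pascalSum, mul_sub, sum_sub_distrib]

/-! ### Base-`p` digits -/

/-- The base-`p` digits of `n` as elements of `ZMod p`. -/
def zdigit (p n j : ℕ) : ZMod p := (baseDigit p n j : ZMod p)

lemma zdigit_eq_of_div_eq {n n' l j : ℕ} (h : n / p ^ l = n' / p ^ l) (hj : l ≤ j) :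
    zdigit p n j = zdigit p n' j := by
  obtain ⟨i, rfl⟩ := Nat.exists_eq_add_of_le hj
  rw [zdigit, zdigit, baseDigit, baseDigit, pow_add, ← Nat.div_div_eq_div_mul,
    ← Nat.div_div_eq_div_mul, h]

lemma zdigit_eq_of_mod_eq {n n' s j : ℕ} (h : n % p ^ s = n' % p ^ s) (hj : j < s) :
    zdigit p n j = zdigit p n' j := by
  have h1 : n % p ^ (j + 1) = n' % p ^ (j + 1) :=
    Nat.ModEq.of_dvd (pow_dvd_pow p (by omega : j + 1 ≤ s)) h
  rw [zdigit, zdigit, baseDigit, baseDigit, ← Nat.mod_mul_right_div_self,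
    ← Nat.mod_mul_right_div_self, ← pow_succ, h1]

lemma mod_pow_eq_of_zdigit_eq [Fact p.Prime] {n n' s : ℕ}
    (h : ∀ j < s, zdigit p n j = zdigit p n' j) : n % p ^ s = n' % p ^ s := by
  induction s with
  | zero => simp [Nat.mod_one]
  | succ s ih =>
    have h1 := h s (by omega)
    rw [zdigit, zdigit, ZMod.natCast_eq_natCast_iff', baseDigit, baseDigit, Nat.mod_mod,
      Nat.mod_mod] at h1
    rw [Nat.mod_pow_succ, Nat.mod_pow_succ, ih fun j hj => h j (by omega), h1]

/-! ### Windows of the necklace -/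

/-- The digit `d_k(n)` of the necklace of order `m` with `z = η = 0`, `u = 1`, as an element
of `ZMod p`. -/
def zentry (p m n k : ℕ) : ZMod p := pascalSum (p ^ m) (zdigit p n) 0 k

/-- The digit of the necklace `r` places after `d_k(n)`: windows that start in the row of `n` may
run over into the row of `n + 1`. -/
def window (p m n k r : ℕ) : ZMod p :=
  if k + r < p ^ m then zentry p m n (k + r) else zentry p m (n + 1) (k + r - p ^ m)

/-- The Pascal matrix modulo `p` continues `p ^ m`-periodically. -/
lemma pascalSum_zero_pow_add [Fact p.Prime] (m r : ℕ) (δ : ℕ → ZMod p) :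
    pascalSum (p ^ m) δ 0 (p ^ m + r) = pascalSum (p ^ m) δ 0 r := by
  refine sum_congr rfl fun j hj => ?_
  rw [add_zero, add_zero, Nat.choose_symm_add, Nat.choose_symm_add, add_assoc,
    cast_choose_pow_add_of_lt p (mem_range.mp hj)]

/-- Inside a row, a window of length `l` determines `n` within its block of length `p ^ l`. -/
lemma eq_of_zentry_eq [Fact p.Prime] {m n n' k l : ℕ} (hl : l ≤ p ^ m)
    (hb : n / p ^ l = n' / p ^ l)
    (hw : ∀ r < l, pascalSum (p ^ m) (zdigit p n) 0 (k + r) =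
      pascalSum (p ^ m) (zdigit p n') 0 (k + r)) : n = n' := by
  have h1 : ∀ j < l, zdigit p n j - zdigit p n' j = 0 := by
    refine eq_zero_of_pascalSum_eq_zero (J := p ^ m) (k := k) hl ?_ ?_
    · intro a _ j hj _
      rw [zdigit_eq_of_div_eq hb hj, sub_self, mul_zero]
    · intro r hr
      rw [pascalSum_sub, hw r hr, sub_self]
  have h2 := mod_pow_eq_of_zdigit_eq fun j hj => sub_eq_zero.mp (h1 j hj)
  rw [← Nat.div_add_mod n (p ^ l), ← Nat.div_add_mod n' (p ^ l), hb, h2]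

/-- For a window that runs over into the next row, the part in the row of `n` consists of the last
`s` entries of that row. It determines `n`, hence `n + 1`, modulo `p ^ s`, and by periodicity the
remaining entries then complete a window of the row of `n + 1`. -/
lemma eq_of_window_eq_of_overlap [Fact p.Prime] {m n n' k l : ℕ} (hk : k < p ^ m)
    (hkl : p ^ m < k + l) (hl : l ≤ p ^ m) (hb : (n + 1) / p ^ l = (n' + 1) / p ^ l)
    (hw : ∀ r < l, window p m n k r = window p m n' k r) : n = n' := by
  obtain ⟨s, hs⟩ := Nat.exists_eq_add_of_lt hk
  have hs' : p ^ m = k + (s + 1) := by omega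
  generalize s + 1 = s at hs'
  clear hs
  have h1 : ∀ j < s, zdigit p n j - zdigit p n' j = 0 := by
    refine eq_zero_of_pascalSum_eq_zero (J := p ^ m) (k := k) (by omega) ?_ ?_
    · intro a ha j hj hjm
      obtain ⟨i, rfl⟩ := Nat.exists_eq_add_of_le hj
      rw [← Nat.choose_symm (by omega), show k + (s + i) - (k + a) = s + i - a by omega,
        show k + (s + i) = p ^ m + i by omega, cast_choose_pow_add_of_lt p (by omega),
        Nat.choose_eq_zero_of_lt (by omega), Nat.cast_zero, zero_mul]
    · intro r hr
      have := hw r (by omega)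
      rw [window, window, if_pos (by omega), if_pos (by omega)] at this
      rw [pascalSum_sub, sub_eq_zero]
      exact this
  have h2 : n % p ^ s = n' % p ^ s :=
    mod_pow_eq_of_zdigit_eq fun j hj => sub_eq_zero.mp (h1 j hj)
  have h3 : (n + 1) % p ^ s = (n' + 1) % p ^ s := Nat.ModEq.add_right 1 h2
  refine Nat.add_right_cancel (m := 1) (eq_of_zentry_eq (m := m) (k := k) hl hb fun r hr => ?_)
  rcases lt_or_ge r s with hrs | hrs
  · rw [← sub_eq_zero, ← pascalSum_sub]
    refine sum_eq_zero fun j hj => ?_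
    beta_reduce
    rcases lt_or_ge j s with hjs | hjs
    · rw [zdigit_eq_of_mod_eq h3 hjs, sub_self, mul_zero]
    · have hj' := mem_range.mp hj
      rw [add_zero, Nat.choose_symm_add, show k + r + j = p ^ m + (r + j - s) by omega,
        cast_choose_pow_add_of_lt p hj', Nat.choose_eq_zero_of_lt (by omega), Nat.cast_zero,
        zero_mul]
  · have := hw r hr
    rw [window, window, if_neg (by omega), if_neg (by omega)] at this
    have e : k + r = p ^ m + (k + r - p ^ m) := by omega
    rw [e, pascalSum_zero_pow_add, pascalSum_zero_pow_add]
    exact this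

/-! ### Counting windows -/

/-- Every block of `p ^ l` consecutive `n` contains a given word of length `l` at most once at
column `k`. -/
lemma card_window_le {p : ℕ} [Fact p.Prime] {m k l : ℕ} (hk : k < p ^ m) (hl : l ≤ p ^ m)
    (v : ℕ → ZMod p) (n₀ : ℕ) :
    ((range n₀).filter fun n => ∀ r < l, window p m n k r = v r).card ≤ n₀ / p ^ l + 1 := by
  rw [← card_range (n₀ / p ^ l + 1)]
  rcases le_or_gt (k + l) (p ^ m) with hkl | hkl
  · refine card_le_card_of_injOn (fun n => n / p ^ l) ?_ ?_
    · intro n hn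
      have hn' := (mem_filter.mp hn).1
      rw [mem_range] at hn'
      exact mem_coe.mpr (mem_range.mpr (Nat.lt_succ_of_le (Nat.div_le_div_right hn'.le)))
    · intro n hn n' hn' hb
      have h1 := (mem_filter.mp hn).2
      have h2 := (mem_filter.mp hn').2
      refine eq_of_zentry_eq (m := m) (k := k) hl hb fun r hr => ?_
      have h3 := (h1 r hr).trans (h2 r hr).symm
      rwa [window, window, if_pos (by omega), if_pos (by omega)] at h3
  · refine card_le_card_of_injOn (fun n => (n + 1) / p ^ l) ?_ ?_
    · intro n hn
      have hn' := (mem_filter.mp hn).1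
      rw [mem_range] at hn'
      exact mem_coe.mpr (mem_range.mpr (Nat.lt_succ_of_le (Nat.div_le_div_right hn')))
    · intro n hn n' hn' hb
      have h1 := (mem_filter.mp hn).2
      have h2 := (mem_filter.mp hn').2
      exact eq_of_window_eq_of_overlap hk hkl hl hb fun r hr => (h1 r hr).trans (h2 r hr).symm

/-- The number `∑ i ≤ T, p ^ (q * i)` of rows: its base-`p` digits are `1` at the multiples of `q`
up to `q * T`, and `0` elsewhere. -/
def sparseRows (p q T : ℕ) : ℕ := ∑ i ∈ range (T + 1), p ^ (q * i)

/-- The word of length `q * t + 2` with letters `1` at the positions congruent to `1` modulo `q`,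
except for a `0` at its last position `q * t + 1`. -/
def levelWord (q t r : ℕ) : ℕ := if r % q = 1 ∧ r ≠ q * t + 1 then 1 else 0

lemma sparseRows_eq_add (p q : ℕ) {t T : ℕ} (h : t ≤ T) :
    ∃ y, sparseRows p q T = sparseRows p q t + p ^ (q * (t + 1)) * y := by
  obtain ⟨d, rfl⟩ := Nat.exists_eq_add_of_le h
  refine ⟨∑ i ∈ range d, p ^ (q * i), ?_⟩
  rw [sparseRows, sparseRows, show t + d + 1 = (t + 1) + d by ring, sum_range_add, mul_sum]
  congr 1
  exact sum_congr rfl fun i _ => by rw [← pow_add, ← mul_add]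

lemma le_sparseRows (p q t : ℕ) : p ^ (q * t) ≤ sparseRows p q t :=
  single_le_sum (f := fun i => p ^ (q * i)) (fun _ _ => Nat.zero_le _) (mem_range.mpr (by omega))

lemma sparseRows_lt {p q : ℕ} (hp : 2 ≤ p) (hq : 1 ≤ q) (t : ℕ) :
    sparseRows p q t < p ^ (q * t + 1) := by
  induction t with
  | zero => simp [sparseRows]; omega
  | succ t ih =>
    rw [sparseRows, sum_range_succ, ← sparseRows]
    have h1 : p ^ (q * t + 1) ≤ p ^ (q * (t + 1)) :=
      Nat.pow_le_pow_right (by omega) (by rw [mul_add]; omega)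
    have h2 : p ^ (q * (t + 1)) * 2 ≤ p ^ (q * (t + 1) + 1) := by
      rw [pow_succ]; exact Nat.mul_le_mul_left _ hp
    omega

lemma sparseRows_mod {p q t T : ℕ} (hp : 2 ≤ p) (hq : 2 ≤ q) (h : t ≤ T) :
    sparseRows p q T % p ^ (q * t + 2) = sparseRows p q t := by
  obtain ⟨y, hy⟩ := sparseRows_eq_add p q h
  obtain ⟨z, hz⟩ := pow_dvd_pow p (show q * t + 2 ≤ q * (t + 1) by rw [mul_add]; omega)
  rw [hy, hz, mul_assoc, Nat.add_mul_mod_self_left, Nat.mod_eq_of_lt]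
  exact (sparseRows_lt hp (by omega) t).trans_le (Nat.pow_le_pow_right (by omega) (by omega))

lemma baseDigit_sparseRows {p q j : ℕ} (hp : 2 ≤ p) (hq : 1 ≤ q) (hj : j % q ≠ 0) (T : ℕ) :
    baseDigit p (sparseRows p q T) j = 0 := by
  have hj' := Nat.div_add_mod j q
  have hjq := Nat.mod_lt j (by omega : 0 < q)
  have hlt : ∀ t ≤ j / q, sparseRows p q t < p ^ j := fun t ht =>
    (sparseRows_lt hp hq t).trans_le (Nat.pow_le_pow_right (by omega) (by
      have := Nat.mul_le_mul_left q ht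
      omega))
  rw [baseDigit]
  rcases le_or_gt T (j / q) with hT | hT
  · rw [Nat.div_eq_of_lt (hlt T hT), Nat.zero_mod]
  · obtain ⟨y, hy⟩ := sparseRows_eq_add p q hT.le
    obtain ⟨z, hz⟩ := pow_dvd_pow p (show j + 1 ≤ q * (j / q + 1) by rw [mul_add]; omega)
    rw [hy, hz, pow_succ, mul_assoc, mul_assoc, Nat.add_mul_div_left _ _ (by positivity),
      Nat.div_eq_of_lt (hlt _ le_rfl), zero_add, Nat.mul_mod_right]

/-- Iterating the difference with step `q` on the sequence `1, …, 1, 0`. -/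
lemma pascalSum_eq_neg_one {p J k h t : ℕ} [Fact p.Prime] {δ : ℕ → ZMod p} (ht : 1 ≤ t)
    (h1 : ∀ i < t, pascalSum J δ 1 (k + p ^ h * i) = 1)
    (h0 : pascalSum J δ 1 (k + p ^ h * t) = 0) : pascalSum J δ (1 + p ^ h * t) k = -1 := by
  have key : ∀ d i, (d + 1 + i < t → pascalSum J δ (1 + p ^ h * (d + 1)) (k + p ^ h * i) = 0) ∧
      (d + 1 + i = t → pascalSum J δ (1 + p ^ h * (d + 1)) (k + p ^ h * i) = -1) := by
    intro d
    induction d with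
    | zero =>
      intro i
      have e : pascalSum J δ (1 + p ^ h * (0 + 1)) (k + p ^ h * i) =
          pascalSum J δ 1 (k + p ^ h * (i + 1)) - pascalSum J δ 1 (k + p ^ h * i) := by
        rw [zero_add, mul_one, pascalSum_add_pow, mul_add, mul_one, add_assoc]
      refine ⟨fun hi => ?_, fun hi => ?_⟩
      · rw [e, h1 _ (by omega), h1 _ (by omega), sub_self]
      · rw [e, show i + 1 = t by omega, h0, h1 _ (by omega), zero_sub]
    | succ d ih =>
      intro i
      have e : pascalSum J δ (1 + p ^ h * (d + 1 + 1)) (k + p ^ h * i) =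
          pascalSum J δ (1 + p ^ h * (d + 1)) (k + p ^ h * (i + 1)) -
            pascalSum J δ (1 + p ^ h * (d + 1)) (k + p ^ h * i) := by
        rw [mul_add _ (d + 1), mul_one, ← add_assoc, pascalSum_add_pow, mul_add _ i, mul_one,
          add_assoc k]
      refine ⟨fun hi => ?_, fun hi => ?_⟩
      · rw [e, (ih _).1 (by omega), (ih _).1 (by omega), sub_self]
      · rw [e, (ih _).2 (by omega), (ih _).1 (by omega), sub_zero]
  obtain ⟨d, rfl⟩ := Nat.exists_eq_add_of_le' ht
  exact (key d 0).2 rfl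

/-- In the columns `k` with `k % q ≠ q - 1`, the last incomplete block of `p ^ (q * t + 2)` rows
below `sparseRows p q T` contains no window equal to the level word. The difference of order
`1 + q * t` of such a window is `-1` by the choice of the word, whereas computed from the digits of
`n` it vanishes: digit `1 + q * t` of `n` is `0`, and the higher digits are those of
`sparseRows p q T`, which sit at multiples of `q`, where the binomial coefficients are
divisible by `p`. -/
lemma card_levelWord_le {p m h k t T : ℕ} [Fact p.Prime] (hh : 1 ≤ h) (ht : 1 ≤ t) (htT : t ≤ T)
    (hk : k + (p ^ h * t + 2) ≤ p ^ m) (hkq : k % p ^ h ≠ p ^ h - 1) :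
    ((range (sparseRows p (p ^ h) T)).filter fun n =>
      ∀ r < p ^ h * t + 2, window p m n k r = levelWord (p ^ h) t r).card ≤
        sparseRows p (p ^ h) T / p ^ (p ^ h * t + 2) := by
  have hp : 2 ≤ p := (Fact.out : p.Prime).two_le
  have hq : 2 ≤ p ^ h := hp.trans (Nat.le_self_pow (by omega) p)
  set n₀ := sparseRows p (p ^ h) T with hn₀
  conv_rhs => rw [← card_range (n₀ / p ^ (p ^ h * t + 2))]
  refine card_le_card_of_injOn (fun n => n / p ^ (p ^ h * t + 2)) ?_ ?_
  · intro n hn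
    obtain ⟨hn', hw⟩ := mem_filter.mp hn
    rw [mem_range] at hn'
    refine mem_coe.mpr (mem_range.mpr ?_)
    by_contra hcon
    have hdiv : n / p ^ (p ^ h * t + 2) = n₀ / p ^ (p ^ h * t + 2) :=
      le_antisymm (Nat.div_le_div_right hn'.le) (not_lt.mp hcon)
    have hmod : n % p ^ (p ^ h * t + 2) < p ^ (p ^ h * t + 1) := by
      have h1 := Nat.div_add_mod n (p ^ (p ^ h * t + 2))
      have h2 := Nat.div_add_mod n₀ (p ^ (p ^ h * t + 2))
      have h3 : n₀ % p ^ (p ^ h * t + 2) < p ^ (p ^ h * t + 1) := by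
        rw [hn₀, sparseRows_mod hp hq htT]
        exact sparseRows_lt hp (by omega) t
      rw [hdiv] at h1
      omega
    have hdigit : baseDigit p n (p ^ h * t + 1) = 0 := by
      rw [baseDigit, ← Nat.mod_mul_right_div_self, ← pow_succ, Nat.div_eq_of_lt hmod]
    have hentry : ∀ r < p ^ h * t + 2,
        pascalSum (p ^ m) (zdigit p n) 0 (k + r) = levelWord (p ^ h) t r := by
      intro r hr
      rw [← hw r hr, window, if_pos (by omega), zentry]
    have hdiff : ∀ i ≤ t, pascalSum (p ^ m) (zdigit p n) 1 (k + p ^ h * i) =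
        if i = t then 0 else 1 := by
      intro i hi
      have hi' := Nat.mul_le_mul_left (p ^ h) hi
      rw [show (1 : ℕ) = 0 + 1 from rfl, pascalSum_succ, add_assoc, hentry _ (by omega),
        hentry _ (by omega), levelWord, levelWord, Nat.mul_add_mod, Nat.mul_mod_right,
        Nat.mod_eq_of_lt (by omega : 0 + 1 < p ^ h)]
      have : p ^ h * i = p ^ h * t ↔ i = t := Nat.mul_right_inj (by omega)
      by_cases hit : i = t <;> simp [this, hit]
    have hneg : pascalSum (p ^ m) (zdigit p n) (1 + p ^ h * t) k = -1 :=
      pascalSum_eq_neg_one ht (fun i hi => by rw [hdiff i hi.le, if_neg hi.ne])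
        (by rw [hdiff t le_rfl, if_pos rfl])
    refine neg_ne_zero.mpr (one_ne_zero (α := ZMod p)) (hneg.symm.trans (sum_eq_zero ?_))
    intro j _
    rcases lt_trichotomy j (p ^ h * t + 1) with hj | rfl | hj
    · rw [Nat.choose_eq_zero_of_lt (by omega), Nat.cast_zero, zero_mul]
    · rw [zdigit, hdigit, Nat.cast_zero, mul_zero]
    · rw [zdigit_eq_of_div_eq hdiv (by omega : p ^ h * t + 2 ≤ j)]
      by_cases hjq : j % p ^ h = 0
      · obtain ⟨i, rfl⟩ := Nat.dvd_of_mod_eq_zero hjq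
        rw [← Nat.choose_symm (by omega), cast_choose_eq_zero p h, zero_mul]
        · have hti : t < i := by
            by_contra hcon
            have := Nat.mul_le_mul_left (p ^ h) (not_lt.mp hcon)
            omega
          obtain ⟨d, rfl⟩ := Nat.exists_eq_add_of_lt hti
          rw [show k + p ^ h * (t + d + 1) - (k + (1 + p ^ h * t)) = p ^ h * d + (p ^ h - 1) by
            rw [mul_add, mul_add]; omega, Nat.mul_add_mod, Nat.mod_eq_of_lt (by omega)]
        · rwa [Nat.add_mul_mod_self_left]
      · rw [zdigit, baseDigit_sparseRows hp (by omega) hjq, Nat.cast_zero, mul_zero]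
  · intro n hn n' hn' hb
    have h1 := (mem_filter.mp hn).2
    have h2 := (mem_filter.mp hn').2
    refine eq_of_zentry_eq (m := m) (k := k) (by omega) hb fun r hr => ?_
    have h3 := (h1 r hr).trans (h2 r hr).symm
    rwa [window, window, if_pos (by omega), if_pos (by omega)] at h3

end AffineNecklace

/-! ### Real numbers and their digits -/

namespace Real

/-- Expansions in base `b` compare lexicographically, up to equality of the values. -/
lemma exists_first_digit_lt_of_ofDigits_lt {b : ℕ} {x y : ℕ → Fin b} (h : ofDigits x < ofDigits y) :
    ∃ r, (∀ s < r, x s = y s) ∧ x r < y r := by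
  classical
  have hne : ∃ r, x r ≠ y r := by
    by_contra! hcon
    rw [funext hcon] at h
    exact lt_irrefl _ h
  refine ⟨Nat.find hne, fun s hs => not_not.mp (Nat.find_min hne hs), ?_⟩
  by_contra hcon
  have hspec := Nat.find_spec hne
  have hpre : ∀ s < Nat.find hne, x s = y s := fun s hs => not_not.mp (Nat.find_min hne hs)
  generalize Nat.find hne = r at hcon hspec hpre
  have hlt : y r < x r := lt_of_le_of_ne (not_lt.mp hcon) (Ne.symm hspec)
  refine absurd h (not_lt.mpr ?_)
  have hb : (0 : ℝ) < ((b : ℝ) ^ (r + 1))⁻¹ := by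
    have : 0 < b := (x 0).pos
    positivity
  rw [ofDigits_eq_sum_add_ofDigits y (r + 1), ofDigits_eq_sum_add_ofDigits x (r + 1),
    sum_range_succ, sum_range_succ,
    sum_congr rfl fun s hs => show ofDigitsTerm x s = ofDigitsTerm y s by
      rw [ofDigitsTerm, ofDigitsTerm, hpre s (mem_range.mp hs)]]
  have h1 : ofDigitsTerm y r + ((b : ℝ) ^ (r + 1))⁻¹ ≤ ofDigitsTerm x r := by
    rw [ofDigitsTerm, ofDigitsTerm, ← add_one_mul]
    refine mul_le_mul_of_nonneg_right ?_ hb.le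
    exact_mod_cast (show (y r : ℕ) + 1 ≤ x r from hlt)
  have h2 := mul_le_of_le_one_right hb.le (ofDigits_le_one fun i => y (i + (r + 1)))
  have h3 := mul_nonneg hb.le (ofDigits_nonneg fun i => x (i + (r + 1)))
  linarith

lemma ofDigits_lt_one {b : ℕ} (hb : 1 < b) {x : ℕ → Fin b} {r : ℕ} (hr : (x r : ℕ) = 0) :
    ofDigits x < 1 := by
  rw [← ofDigits_const_last_eq_one' hb]
  have hcast : (((b - 1 : ℕ) : ℝ)) = b - 1 := by rw [Nat.cast_sub hb.le, Nat.cast_one]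
  refine Summable.tsum_lt_tsum_of_nonneg (i := r) (fun _ => ofDigitsTerm_nonneg) (fun i => ?_) ?_
    summable_ofDigitsTerm
  · refine ofDigitsTerm_le.trans_eq ?_
    simp [ofDigitsTerm, hcast]
  · have : (0 : ℝ) < b - 1 := by rw [← hcast]; exact_mod_cast Nat.sub_pos_of_lt hb
    simp only [ofDigitsTerm, hr, hcast, Nat.cast_zero, zero_mul]
    positivity

lemma fract_pow_mul_ofDigits {b : ℕ} (a : ℕ → Fin b) (i : ℕ)
    (h : ofDigits (fun r => a (r + i)) < 1) :
    Int.fract ((b : ℝ) ^ i * ofDigits a) = ofDigits (fun r => a (r + i)) := by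
  have hb : (b : ℝ) ≠ 0 := by exact_mod_cast (a 0).pos.ne'
  rw [Int.fract_eq_iff]
  refine ⟨ofDigits_nonneg _, h, ∑ j ∈ range i, (a j : ℕ) * (b : ℤ) ^ (i - (j + 1)), ?_⟩
  rw [ofDigits_eq_sum_add_ofDigits a i, mul_add, mul_inv_cancel_left₀ (pow_ne_zero _ hb),
    add_sub_cancel_right, mul_sum]
  push_cast
  refine sum_congr rfl fun j hj => ?_
  rw [ofDigitsTerm, pow_sub₀ _ hb (show j + 1 ≤ i from mem_range.mp hj)]
  ring

end Real

namespace AffineNecklace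

/-- The base-`p` digits of the right end point `c = ∑ t ≤ T, p ^ (-(q * t + 2))`. -/
def endDigits (p : ℕ) [NeZero p] (q T r : ℕ) : Fin p :=
  Fin.ofNat p (if r % q = 1 ∧ r / q ≤ T then 1 else 0)

/-- The right end point `c = ∑ t ≤ T, p ^ (-(q * t + 2))` of the interval `[0, c)`. -/
noncomputable def endPoint (p q T : ℕ) : ℝ :=
  ∑ t ∈ range (T + 1), ((p : ℝ) ^ (q * t + 2))⁻¹

lemma ofDigits_endDigits {p q : ℕ} [NeZero p] (hp : 2 ≤ p) (hq : 2 ≤ q) (T : ℕ) :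
    Real.ofDigits (endDigits p q T) = endPoint p q T := by
  have hval : ∀ r, ((endDigits p q T r : ℕ) : ℝ) = if r % q = 1 ∧ r / q ≤ T then 1 else 0 := by
    intro r
    rw [endDigits, Fin.val_ofNat, Nat.mod_eq_of_lt (by split_ifs <;> omega)]
    split_ifs <;> simp
  have hinj : Set.InjOn (fun t => q * t + 1) (range (T + 1)) := fun t _ t' _ h =>
    Nat.eq_of_mul_eq_mul_left (by omega : 0 < q) (Nat.add_right_cancel h)
  rw [Real.ofDigits, tsum_eq_sum (s := (range (T + 1)).image fun t => q * t + 1), sum_image hinj,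
    endPoint]
  · refine sum_congr rfl fun t ht => ?_
    rw [Real.ofDigitsTerm, hval, if_pos, one_mul]
    rw [Nat.mul_add_mod, Nat.mod_eq_of_lt (by omega), Nat.mul_add_div (by omega),
      Nat.div_eq_of_lt (by omega), add_zero]
    exact ⟨rfl, Nat.le_of_lt_succ (mem_range.mp ht)⟩
  · intro r hr
    rw [Real.ofDigitsTerm, hval, if_neg, zero_mul]
    rintro ⟨h1, h2⟩
    refine hr (mem_image.mpr ⟨r / q, mem_range.mpr (Nat.lt_succ_of_le h2), ?_⟩)
    have := Nat.div_add_mod r q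
    omega

/-- A number below the end point agrees with it up to a digit `1`, in place of which it has the
digit `0`: its expansion starts with one of the level words. -/
lemma exists_levelWord_of_lt {p q : ℕ} [NeZero p] (hp : 2 ≤ p) (hq : 2 ≤ q) {T : ℕ}
    {x : ℕ → Fin p} (hx : Real.ofDigits x < endPoint p q T) :
    ∃ t ≤ T, ∀ r < q * t + 2, (x r : ℕ) = levelWord q t r := by
  rw [← ofDigits_endDigits hp hq] at hx
  have hval : ∀ r, ((endDigits p q T r : Fin p) : ℕ) = if r % q = 1 ∧ r / q ≤ T then 1 else 0 := by
    intro r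
    rw [endDigits, Fin.val_ofNat, Nat.mod_eq_of_lt (by split_ifs <;> omega)]
  obtain ⟨r, hpre, hr⟩ := Real.exists_first_digit_lt_of_ofDigits_lt hx
  rw [Fin.lt_def, hval] at hr
  have hrT : r % q = 1 ∧ r / q ≤ T := by
    by_contra hcon
    rw [if_neg hcon] at hr
    omega
  rw [if_pos hrT] at hr
  have hdm := Nat.div_add_mod r q
  refine ⟨r / q, hrT.2, fun s hs => ?_⟩
  rw [levelWord]
  rcases eq_or_ne s r with rfl | hsr
  · rw [if_neg (by omega)]
    omega
  · rw [hpre s (by omega), hval]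
    have hsT : s / q ≤ T := (Nat.div_le_div_right (by omega : s ≤ r)).trans hrT.2
    congr 1
    rw [eq_iff_iff]
    exact ⟨fun h => ⟨h.1, by omega⟩, fun h => ⟨h.1, hsT⟩⟩

/-! ### The concatenation of the necklaces -/

lemma start_succ (p : ℕ) {m : ℕ} (hm : 1 ≤ m) : start p (m + 1) = start p m + length p m :=
  sum_Ico_succ_top hm _

lemma start_mono (p : ℕ) : Monotone (start p) := fun _ _ h =>
  sum_le_sum_of_subset (Ico_subset_Ico_right h)

lemma concat_start_add {p : ℕ} [NeZero p] (z η u : ℕ → ℕ → ℕ) {m r : ℕ} (hm : 1 ≤ m)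
    (hr : r < length p m) :
    concat p z η u (start p m + r) = entry p m (z m) (η m) (u m) r := by
  have hb : blockIndex p (start p m + r) = m := by
    refine le_antisymm (Nat.sInf_le ?_) ?_
    · rw [Set.mem_ofPred_eq, start_succ p hm]
      omega
    · refine le_csInf ⟨m, ?_⟩ fun m' hm' => ?_
      · rw [Set.mem_ofPred_eq, start_succ p hm]
        omega
      · rw [Set.mem_ofPred_eq] at hm'
        by_contra hcon
        have := start_mono p (show m' + 1 ≤ m by omega)
        omega
  rw [concat, hb, Nat.add_sub_cancel_left]

/-- The digits of Levin's number. -/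
noncomputable def levinDigits (p : ℕ) [NeZero p] : ℕ → Fin p :=
  concat p (fun _ _ => 0) (fun _ _ => 0) (fun _ _ => 1)

lemma cast_digit {p : ℕ} [NeZero p] (m n k : ℕ) :
    ((digit p m (fun _ => 0) (fun _ => 0) (fun _ => 1) n k : ℕ) : ZMod p) = zentry p m n k := by
  rw [digit, Fin.val_ofNat, ZMod.natCast_mod, zentry, pascalSum]
  push_cast
  rw [add_zero]
  refine sum_congr rfl fun j _ => ?_
  rw [coeff, mul_one, Nat.sub_zero, add_zero, Nat.choose_symm_add, zdigit]

lemma cast_levinDigits {p : ℕ} [NeZero p] {m n k r : ℕ} (hm : 1 ≤ m) (hk : k < p ^ m)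
    (hr : r ≤ p ^ m) (hn : n + 1 < p ^ p ^ m) :
    ((levinDigits p (start p m + (p ^ m * n + k) + r) : ℕ) : ZMod p) = window p m n k r := by
  have hM : 0 < p ^ m := by omega
  have hlen : p ^ m * (n + 1) + p ^ m ≤ length p m := by
    rw [length, ← Nat.mul_succ]
    exact Nat.mul_le_mul_left _ hn
  rw [mul_add, mul_one] at hlen
  rw [levinDigits, add_assoc, concat_start_add _ _ _ hm (by omega), entry, cast_digit, window,
    add_assoc]
  split_ifs with h
  · rw [Nat.mul_add_div hM, Nat.mul_add_mod, Nat.div_eq_of_lt h, Nat.mod_eq_of_lt h, add_zero]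
  · rw [show p ^ m * n + (k + r) = p ^ m * (n + 1) + (k + r - p ^ m) by
      rw [mul_add]; omega, Nat.mul_add_div hM, Nat.mul_add_mod,
      Nat.div_eq_of_lt (by omega : k + r - p ^ m < p ^ m),
      Nat.mod_eq_of_lt (by omega : k + r - p ^ m < p ^ m), add_zero]

/-- Every necklace starts with the digit `0`. -/
lemma levinDigits_start {p : ℕ} [NeZero p] {m : ℕ} (hm : 1 ≤ m) :
    (levinDigits p (start p m) : ℕ) = 0 := by
  have hp : 0 < p := NeZero.pos p
  have h := concat_start_add (p := p) (fun _ _ => 0) (fun _ _ => 0) (fun _ _ => 1) hm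
    (show 0 < length p m by rw [length]; positivity)
  rw [add_zero] at h
  rw [levinDigits, h, entry, digit, Fin.val_ofNat]
  simp [baseDigit]

lemma le_start {p : ℕ} (hp : 0 < p) {m : ℕ} (hm : 1 ≤ m) : m ≤ start p m + 1 := by
  induction m, hm using Nat.le_induction with
  | base => omega
  | succ m hm ih =>
    have : 0 < length p m := by rw [length]; positivity
    rw [start_succ p hm]
    omega

/-- The shifts of Levin's number have the shifted digit sequences as expansions, because no tail of
the digit sequence consists of digits `p - 1` only. -/
lemma fract_pow_mul_levinNumber {p : ℕ} [NeZero p] (hp : 2 ≤ p) (i : ℕ) :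
    Int.fract ((p : ℝ) ^ i * levinNumber p) = Real.ofDigits fun r => levinDigits p (r + i) := by
  refine Real.fract_pow_mul_ofDigits (levinDigits p) i ?_
  have h1 := le_start (by omega : 0 < p) (show 1 ≤ i + 1 by omega)
  refine Real.ofDigits_lt_one (by omega) (r := start p (i + 1) - i) ?_
  rw [Nat.sub_add_cancel (by omega)]
  exact levinDigits_start (by omega)

end AffineNecklace

/-! ### Discrepancy -/

lemma abs_card_sub_le_mul_starDiscrepancy (x : ℕ → ℝ) {N : ℕ} (hN : 0 < N) {c : ℝ} (h0 : 0 < c)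
    (h1 : c ≤ 1) :
    |(((range N).filter fun n => 0 ≤ x n ∧ x n < c).card : ℝ) - N * c| ≤
      N * starDiscrepancy x N := by
  have hN' : (0 : ℝ) < N := by exact_mod_cast hN
  have hbdd : BddAbove (Set.range fun c : Set.Ioc (0 : ℝ) 1 =>
      |(((range N).filter (fun n => 0 ≤ x n ∧ x n < (c : ℝ))).card : ℝ) / (N : ℝ) - (c : ℝ)|) := by
    refine ⟨1, ?_⟩
    rintro _ ⟨⟨c, hc0, hc1⟩, rfl⟩
    have h2 : (((range N).filter fun n => 0 ≤ x n ∧ x n < c).card : ℝ) ≤ N := by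
      exact_mod_cast (card_filter_le _ _).trans_eq (card_range N)
    have h3 := div_le_one_of_le₀ h2 hN'.le
    have h4 : 0 ≤ (((range N).filter fun n => 0 ≤ x n ∧ x n < c).card : ℝ) / N := by positivity
    exact abs_le.mpr ⟨by simp only; linarith, by simp only; linarith⟩
  have h2 := mul_le_mul_of_nonneg_left (le_ciSup hbdd ⟨c, h0, h1⟩) hN'.le
  refine le_trans (le_of_eq ?_) h2
  rw [← abs_of_pos hN', ← abs_mul, abs_of_pos hN', mul_sub, mul_div_cancel₀ _ hN'.ne']

namespace AffineNecklace

/-- The `n < n₀` at which the window at column `k` is the level word of level `t`. -/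
def levelRows (p m q n₀ k t : ℕ) [NeZero p] : Finset ℕ :=
  (range n₀).filter fun n => ∀ r < q * t + 2, window p m n k r = levelWord q t r

/-- The points below the end point that come from the first `n₀` rows of the necklace of
order `m`. -/
lemma card_points_le {p m q T n₀ : ℕ} [NeZero p] (hp : 2 ≤ p) (hq : 2 ≤ q) (hm : 1 ≤ m)
    (hT : q * T + 2 ≤ p ^ m) (hn₀ : n₀ < p ^ p ^ m) :
    ((range (start p m + p ^ m * n₀)).filter fun i =>
      0 ≤ Int.fract ((p : ℝ) ^ i * levinNumber p) ∧
        Int.fract ((p : ℝ) ^ i * levinNumber p) < endPoint p q T).card ≤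
    ((range (start p m)).filter fun i => 0 ≤ Int.fract ((p : ℝ) ^ i * levinNumber p) ∧
        Int.fract ((p : ℝ) ^ i * levinNumber p) < endPoint p q T).card +
      ∑ k ∈ range (p ^ m), ∑ t ∈ range (T + 1), (levelRows p m q n₀ k t).card := by
  rw [← sum_product' (f := fun k t => (levelRows p m q n₀ k t).card)]
  refine le_trans (card_le_card ?_) ((card_union_le _ ((range (p ^ m) ×ˢ range (T + 1)).biUnion
    fun kt => (levelRows p m q n₀ kt.1 kt.2).image fun n => start p m + (p ^ m * n + kt.1))).trans
    (Nat.add_le_add_left (card_biUnion_le.trans (sum_le_sum fun kt _ => card_image_le)) _))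
  intro i hi
  obtain ⟨hiN, hi⟩ := mem_filter.mp hi
  rw [mem_range] at hiN
  rcases lt_or_ge i (start p m) with hlt | hge
  · exact mem_union_left _ (mem_filter.mpr ⟨mem_range.mpr hlt, hi⟩)
  · refine mem_union_right _ ?_
    have hM : 0 < p ^ m := by positivity
    obtain ⟨j, rfl⟩ := Nat.exists_eq_add_of_le hge
    have hdm := Nat.div_add_mod j (p ^ m)
    have hk := Nat.mod_lt j hM
    have hn : j / p ^ m < n₀ := Nat.div_lt_of_lt_mul (by omega)
    have hlt := hi.2
    rw [fract_pow_mul_levinNumber hp] at hlt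
    obtain ⟨t, ht, hw⟩ := exists_levelWord_of_lt hp hq hlt
    have hqt := Nat.mul_le_mul_left q ht
    refine mem_biUnion.mpr ⟨(j % p ^ m, t), mem_product.mpr
      ⟨mem_range.mpr hk, mem_range.mpr (Nat.lt_succ_of_le ht)⟩, mem_image.mpr
      ⟨j / p ^ m, mem_filter.mpr ⟨mem_range.mpr hn, fun r hr => ?_⟩, by rw [hdm]⟩⟩
    have hr' : r < q * t + 2 := hr
    rw [← cast_levinDigits hm hk (by omega) (by omega), hdm, add_comm _ r, hw r hr]

lemma card_levelRows_le {p m q n₀ k t : ℕ} [Fact p.Prime] (hk : k < p ^ m)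
    (ht : q * t + 2 ≤ p ^ m) :
    ((levelRows p m q n₀ k t).card : ℝ) ≤ n₀ * ((p : ℝ) ^ (q * t + 2))⁻¹ + 1 := by
  have h1 : ((levelRows p m q n₀ k t).card : ℝ) ≤ ((n₀ / p ^ (q * t + 2) : ℕ) : ℝ) + 1 := by
    exact_mod_cast card_window_le hk ht _ n₀
  refine h1.trans (add_le_add_left ?_ 1)
  rw [← div_eq_mul_inv]
  exact_mod_cast (Nat.cast_div_le (m := n₀) (n := p ^ (q * t + 2)) (α := ℝ))

/-- In the good columns every level `t ≥ 1` has a deficit of at least `p ^ (-2)`. -/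
lemma card_levelRows_le_sub {p m h T k t : ℕ} [Fact p.Prime] (hh : 1 ≤ h) (ht : 1 ≤ t)
    (htT : t ≤ T) (hk : k + (p ^ h * t + 2) ≤ p ^ m) (hkq : k % p ^ h ≠ p ^ h - 1) :
    ((levelRows p m (p ^ h) (sparseRows p (p ^ h) T) k t).card : ℝ) ≤
      sparseRows p (p ^ h) T * ((p : ℝ) ^ (p ^ h * t + 2))⁻¹ - ((p : ℝ) ^ 2)⁻¹ := by
  have hp : 2 ≤ p := (Fact.out : p.Prime).two_le
  have hp0 : (p : ℝ) ≠ 0 := by positivity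
  have hq : 2 ≤ p ^ h := hp.trans (Nat.le_self_pow (by omega) p)
  have h1 : ((levelRows p m (p ^ h) (sparseRows p (p ^ h) T) k t).card : ℝ) ≤
      ((sparseRows p (p ^ h) T / p ^ (p ^ h * t + 2) : ℕ) : ℝ) := by
    exact_mod_cast card_levelWord_le hh ht htT hk hkq
  refine h1.trans ?_
  have h2 : p ^ (p ^ h * t + 2) * (sparseRows p (p ^ h) T / p ^ (p ^ h * t + 2)) +
      p ^ (p ^ h * t) ≤ sparseRows p (p ^ h) T := by
    have h3 := Nat.div_add_mod (sparseRows p (p ^ h) T) (p ^ (p ^ h * t + 2))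
    rw [sparseRows_mod hp hq htT] at h3
    have := le_sparseRows p (p ^ h) t
    omega
  generalize sparseRows p (p ^ h) T / p ^ (p ^ h * t + 2) = y at h2
  have h3 : (p : ℝ) ^ (p ^ h * t + 2) * y + (p : ℝ) ^ (p ^ h * t) ≤ sparseRows p (p ^ h) T := by
    exact_mod_cast h2
  have hpos : (0 : ℝ) < ((p : ℝ) ^ (p ^ h * t + 2))⁻¹ := by positivity
  have h4 := mul_le_mul_of_nonneg_right h3 hpos.le
  have h5 : ((p : ℝ) ^ (p ^ h * t + 2) * y + (p : ℝ) ^ (p ^ h * t)) *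
      ((p : ℝ) ^ (p ^ h * t + 2))⁻¹ = y + ((p : ℝ) ^ 2)⁻¹ := by
    rw [pow_add]
    field_simp
  linarith

/-- The columns in which the deficit is not available: those with windows that run over into the
next row, and those congruent to `-1` modulo `q`. -/
def badColumns (p m q L : ℕ) : Finset ℕ :=
  (range (p ^ m)).filter fun k => p ^ m < k + L ∨ k % q = q - 1

lemma card_badColumns_le {p m h L : ℕ} (hp : 0 < p) (hm : h ≤ m) :
    (badColumns p m (p ^ h) L).card ≤ p ^ (m - h) + L := by
  have hq : 0 < p ^ h := by positivity
  rw [badColumns, filter_or, union_comm]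
  refine (card_union_le _ _).trans (add_le_add ?_ ?_)
  · rw [← card_range (p ^ (m - h))]
    refine card_le_card_of_injOn (fun k => k / p ^ h) ?_ ?_
    · intro k hk
      have hk' := mem_range.mp (mem_filter.mp hk).1
      refine mem_coe.mpr (mem_range.mpr (Nat.div_lt_of_lt_mul ?_))
      rwa [← pow_add, Nat.add_sub_cancel' hm]
    · intro k hk k' hk' he
      have h1 := (mem_filter.mp hk).2
      have h2 := (mem_filter.mp hk').2
      simp only at he
      rw [← Nat.div_add_mod k (p ^ h), ← Nat.div_add_mod k' (p ^ h), h1, h2, he]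
  · refine (card_le_card (t := Ico (p ^ m - L) (p ^ m)) fun k hk => ?_).trans ?_
    · have h1 := mem_range.mp (mem_filter.mp hk).1
      have h2 := (mem_filter.mp hk).2
      exact mem_Ico.mpr ⟨by omega, h1⟩
    · rw [Nat.card_Ico]
      omega

/-- Summation over all levels and columns. -/
lemma sum_card_levelRows_le {p m h T : ℕ} [Fact p.Prime] (hh : 1 ≤ h)
    (hT : p ^ h * T + 2 ≤ p ^ m) :
    ((∑ k ∈ range (p ^ m), ∑ t ∈ range (T + 1),
      (levelRows p m (p ^ h) (sparseRows p (p ^ h) T) k t).card : ℕ) : ℝ) ≤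
      (p : ℝ) ^ m * sparseRows p (p ^ h) T * endPoint p (p ^ h) T + (p : ℝ) ^ m
        + T * (badColumns p m (p ^ h) (p ^ h * T + 2)).card
        - T * ((p : ℝ) ^ m - (badColumns p m (p ^ h) (p ^ h * T + 2)).card) * ((p : ℝ) ^ 2)⁻¹ := by
  set n₀ := sparseRows p (p ^ h) T with hn₀
  have hcol : ∀ k ∈ range (p ^ m),
      (∑ t ∈ range (T + 1), ((levelRows p m (p ^ h) n₀ k t).card : ℝ)) ≤
        n₀ * endPoint p (p ^ h) T + 1 +
          (if p ^ m < k + (p ^ h * T + 2) ∨ k % p ^ h = p ^ h - 1 then (T : ℝ) +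
            T * ((p : ℝ) ^ 2)⁻¹ else 0) - T * ((p : ℝ) ^ 2)⁻¹ := by
    intro k hk
    have hk' := mem_range.mp hk
    have hlev : ∀ t ∈ range T, ((levelRows p m (p ^ h) n₀ k (t + 1)).card : ℝ) ≤
        n₀ * ((p : ℝ) ^ (p ^ h * (t + 1) + 2))⁻¹ +
          ((if p ^ m < k + (p ^ h * T + 2) ∨ k % p ^ h = p ^ h - 1 then 1 +
            ((p : ℝ) ^ 2)⁻¹ else 0) - ((p : ℝ) ^ 2)⁻¹) := by
      intro t ht
      have htT : t + 1 ≤ T := mem_range.mp ht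
      have := Nat.mul_le_mul_left (p ^ h) htT
      split_ifs with hbad
      · rw [add_sub_cancel_right]
        exact card_levelRows_le hk' (by omega)
      · rw [zero_sub, ← sub_eq_add_neg]
        exact card_levelRows_le_sub hh (by omega) htT (by omega) (by omega)
    have hzero := card_levelRows_le (q := p ^ h) (n₀ := n₀) (t := 0) hk' (by omega)
    rw [sum_range_succ', endPoint, sum_range_succ']
    refine (add_le_add (sum_le_sum hlev) hzero).trans_eq ?_
    rw [sum_add_distrib, ← mul_sum, sum_const, card_range, nsmul_eq_mul]
    split_ifs <;> ring
  push_cast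
  refine (sum_le_sum hcol).trans_eq ?_
  rw [sum_sub_distrib, sum_add_distrib, ← sum_filter, ← badColumns]
  simp only [sum_const, card_range, nsmul_eq_mul]
  push_cast
  ring

lemma start_succ_le {p : ℕ} (hp : 2 ≤ p) (m : ℕ) : start p (m + 1) ≤ p ^ (3 * p ^ m) := by
  have h1 : start p (m + 1) ≤ m * length p m := by
    refine (sum_le_card_nsmul _ _ (length p m) fun j hj => ?_).trans_eq (by simp)
    have hj' : j ≤ m := Nat.le_of_lt_succ (mem_Ico.mp hj).2
    have h2 : p ^ j ≤ p ^ m := Nat.pow_le_pow_right (by omega) hj'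
    exact Nat.mul_le_mul h2 (Nat.pow_le_pow_right (by omega) h2)
  have h2 : m ≤ p ^ m := (Nat.lt_pow_self (by omega)).le
  have h3 : p ^ m ≤ p ^ p ^ m := (Nat.lt_pow_self (by omega)).le
  refine h1.trans ?_
  rw [length, show 3 * p ^ m = p ^ m + (p ^ m + p ^ m) by ring, pow_add, pow_add]
  exact Nat.mul_le_mul (h2.trans h3) (Nat.mul_le_mul_right _ h3)

lemma log_le_of_le_start {p m N : ℕ} (hp : 2 ≤ p) (hN : N ≤ start p (m + 1)) :
    Real.log N ≤ 3 * (p : ℝ) ^ m * p := by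
  rcases Nat.eq_zero_or_pos N with rfl | hpos
  · rw [Nat.cast_zero, Real.log_zero]
    positivity
  · have h1 : (N : ℝ) ≤ (p : ℝ) ^ (3 * p ^ m) := by
      exact_mod_cast hN.trans (start_succ_le hp m)
    have h2 := Real.log_le_log (by exact_mod_cast hpos) h1
    rw [Real.log_pow] at h2
    refine h2.trans ?_
    push_cast
    exact mul_le_mul_of_nonneg_left (Real.log_le_self (by positivity)) (by positivity)

/-- With `q = p ^ 4` the bad columns make up a proportion of at most `2 * p ^ (-4)`, too little to
make up for the deficit `p ^ (-2)` of the others. -/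
lemma deficit_le {P X B : ℝ} (hP : 2 ≤ P) (hX : P ^ 6 ≤ X) (hB : B ≤ 2 * (P ^ 4 * X)) :
    P ^ 8 * X + (X - 1) * B - (X - 1) * (P ^ 8 * X - B) * (P ^ 2)⁻¹ ≤ -(P ^ 6 * X ^ 2 / 8) := by
  have hP2 : 4 ≤ P ^ 2 := by nlinarith
  obtain ⟨S, hS⟩ : ∃ S, S = P ^ 2 := ⟨_, rfl⟩
  have e4 : P ^ 4 = S ^ 2 := by rw [hS]; ring
  have e6 : P ^ 6 = S ^ 3 := by rw [hS]; ring
  have e8 : P ^ 8 = S ^ 4 := by rw [hS]; ring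
  rw [e8, e6, ← hS]
  rw [e6] at hX
  rw [e4] at hB
  rw [← hS] at hP2
  have hS0 : 0 < S := by linarith
  have hS2 : 16 ≤ S ^ 2 := by nlinarith
  have hS3 : 16 * S ≤ S ^ 3 := by nlinarith
  have hXS : 16 * S ≤ X := hS3.trans hX
  have hX0 : 0 < X := by linarith
  have hX1 : 0 ≤ X - 1 := by linarith
  have hinv : 0 < S⁻¹ := by positivity
  -- Both occurrences of `B` have a nonnegative coefficient.
  have h1 : S ^ 4 * X + (X - 1) * B - (X - 1) * (S ^ 4 * X - B) * S⁻¹ ≤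
      S ^ 4 * X + (X - 1) * (2 * (S ^ 2 * X)) -
        (X - 1) * (S ^ 4 * X - 2 * (S ^ 2 * X)) * S⁻¹ := by
    have h2 := mul_le_mul_of_nonneg_left hB hX1
    have h3 := mul_le_mul_of_nonneg_right h2 hinv.le
    linarith
  refine h1.trans ?_
  have h4 : (X - 1) * (S ^ 4 * X - 2 * (S ^ 2 * X)) * S⁻¹ =
      (X - 1) * X * (S ^ 3 - 2 * S) := by
    field_simp
  rw [h4]
  have h5 : 2 * S ^ 2 - (S ^ 3 - 2 * S) ≤ -(3 / 8 * S ^ 3) := by nlinarith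
  have h6 := mul_le_mul_of_nonneg_left h5 (mul_nonneg hX1 hX0.le)
  have h7 : S - 3 / 8 * (X - 1) ≤ -(X / 8) := by linarith
  have h8 := mul_le_mul_of_nonneg_left h7 (show 0 ≤ S ^ 3 * X by positivity)
  linarith

end AffineNecklace

open AffineNecklace

/-- Between the start of the necklace of order `m` and the end of its first
`sparseRows p (p ^ 4) T` rows, the interval `[0, c)` is hit too rarely, so that one of these two
positions is a suitable `N`. -/
lemma exists_discrepancy_ge {p m : ℕ} [Fact p.Prime] (hm : 14 ≤ m) :
    ∃ N, start p m ≤ N ∧ N ≤ start p (m + 1) ∧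
      (p : ℝ) ^ (2 * m) / (16 * (p : ℝ) ^ 10) ≤
        N * starDiscrepancy (fun n => Int.fract ((p : ℝ) ^ n * levinNumber p)) N := by
  have hp : 2 ≤ p := (Fact.out : p.Prime).two_le
  have hp' : (2 : ℝ) ≤ p := by exact_mod_cast hp
  have hq : 2 ≤ p ^ 4 := hp.trans (Nat.le_self_pow (by omega) p)
  obtain ⟨d, rfl⟩ := Nat.exists_eq_add_of_le hm
  have hX1 : 1 ≤ p ^ (d + 6) := Nat.one_le_pow _ _ (by omega)
  obtain ⟨T, hT⟩ := Nat.exists_eq_add_of_le' hX1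
  have hL : p ^ 4 * T + 2 ≤ p ^ (d + 10) := by
    rw [show d + 10 = 4 + (d + 6) by ring, pow_add, hT, mul_add]
    omega
  have hLM : p ^ 4 * T + 2 ≤ p ^ (14 + d) :=
    hL.trans (Nat.pow_le_pow_right (by omega) (by omega))
  set n₀ := sparseRows p (p ^ 4) T with hn₀
  have hn₀M : n₀ < p ^ p ^ (14 + d) :=
    (sparseRows_lt hp (by omega) T).trans_le (Nat.pow_le_pow_right (by omega) (by omega))
  have hstart : 0 < start p (14 + d) := by
    have := le_start (p := p) (m := 14 + d) (by omega) (by omega)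
    omega
  have hc0 : 0 < endPoint p (p ^ 4) T :=
    sum_pos (fun _ _ => by positivity) ⟨0, mem_range.mpr (by omega)⟩
  have hc1 : endPoint p (p ^ 4) T ≤ 1 := by
    rw [← ofDigits_endDigits hp hq]
    exact Real.ofDigits_le_one _
  have hend : start p (14 + d) + p ^ (14 + d) * n₀ ≤ start p (14 + d + 1) := by
    rw [start_succ p (by omega), length]
    exact Nat.add_le_add_left (Nat.mul_le_mul_left _ hn₀M.le) _
  have hcard := card_points_le (q := p ^ 4) (T := T) hp hq (show 1 ≤ 14 + d by omega) hLM hn₀M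
  have hsum := sum_card_levelRows_le (m := 14 + d) (h := 4) (T := T) (by omega) hLM
  have hB : (badColumns p (14 + d) (p ^ 4) (p ^ 4 * T + 2)).card ≤ 2 * p ^ (d + 10) := by
    have := card_badColumns_le (p := p) (m := 14 + d) (h := 4) (L := p ^ 4 * T + 2) (by omega)
      (by omega)
    rw [show 14 + d - 4 = d + 10 by omega] at this
    omega
  have hB' : ((badColumns p (14 + d) (p ^ 4) (p ^ 4 * T + 2)).card : ℝ) ≤
      2 * ((p : ℝ) ^ 4 * (p : ℝ) ^ (d + 6)) := by
    rw [← pow_add, show 4 + (d + 6) = d + 10 by ring]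
    exact_mod_cast hB
  have hdef := deficit_le hp' (pow_le_pow_right₀ (by linarith) (by omega : 6 ≤ d + 6)) hB'
  have hT' : (T : ℝ) = (p : ℝ) ^ (d + 6) - 1 := by
    rw [eq_sub_iff_add_eq]
    exact_mod_cast hT.symm
  have e1 : (p : ℝ) ^ 8 * (p : ℝ) ^ (d + 6) = (p : ℝ) ^ (14 + d) := by ring
  have e2 : (p : ℝ) ^ 6 * ((p : ℝ) ^ (d + 6)) ^ 2 / 8 =
      2 * ((p : ℝ) ^ (2 * (14 + d)) / (16 * (p : ℝ) ^ 10)) := by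
    field_simp
    ring
  rw [e1, ← hT', e2] at hdef
  have hD1 := abs_card_sub_le_mul_starDiscrepancy
    (fun n => Int.fract ((p : ℝ) ^ n * levinNumber p)) hstart hc0 hc1
  have hD2 := abs_card_sub_le_mul_starDiscrepancy
    (fun n => Int.fract ((p : ℝ) ^ n * levinNumber p))
    (N := start p (14 + d) + p ^ (14 + d) * n₀) (by omega) hc0 hc1
  have hcard' := (Nat.cast_le (α := ℝ)).mpr hcard
  rw [Nat.cast_add] at hcard'
  by_contra! hcon
  have h1 := hcon _ le_rfl (start_mono p (Nat.le_succ _))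
  have h2 := hcon _ (Nat.le_add_right _ _) hend
  have h3 := (abs_le.mp (hD1.trans h1.le)).2
  have h4 := (abs_lt.mp (hD2.trans_lt h2)).1
  push_cast at h4 hsum hcard'
  linarith

theorem theorem2 (p : ℕ) [Fact p.Prime] :
    ∃ c : ℝ, 0 < c ∧
      {N : ℕ | c * Real.log (N : ℝ) ^ 2 ≤
        (N : ℝ) * starDiscrepancy (fun n => Int.fract ((p : ℝ) ^ n * levinNumber p)) N}.Infinite := by
  have hp : 2 ≤ p := (Fact.out : p.Prime).two_le
  have hp0 : (0 : ℝ) < p := by positivity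
  refine ⟨1 / (144 * (p : ℝ) ^ 12), by positivity, Set.infinite_of_forall_exists_gt fun a => ?_⟩
  obtain ⟨N, hN1, hN2, hN⟩ := exists_discrepancy_ge (p := p) (m := a + 14) (by omega)
  refine ⟨N, ?_, ?_⟩
  · refine le_trans ?_ hN
    have h1 := log_le_of_le_start hp hN2
    have h2 := pow_le_pow_left₀ (Real.log_natCast_nonneg N) h1 2
    refine (mul_le_mul_of_nonneg_left h2 (by positivity)).trans_eq ?_
    field_simp
    ring
  · have := le_start (p := p) (m := a + 14) (by omega) (by omega)
    omega
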